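/- Let $\mathcal H = F/[F,[F,F]]$ be the Heisenberg Lie algebra over $\mathbb Z$, where $F$ is the free Lie algebra over $\mathbb Z$ on two generators; $\mathcal H$ is free of rank $3$ as a $\mathbb Z$-module. Put $$\Delta_{\mathcal H}=\mathrm{End}_{\mathbb Z}(\mathcal H)\cap \mathrm{Aut}_{\mathbb Q}(\mathcal H\otimes\mathbb Q),\qquad \Gamma_{\mathcal H}=\mathrm{Aut}_{\mathbb Z}(\mathcal H),$$ and for each prime $p$ $$\Delta_{\mathcal H_p}=\mathrm{End}_{\mathbb Z_p}(\mathcal H\otimes\mathbb Z_p)\cap \mathrm{Aut}_{\mathbb Q_p}(\mathcal H\otimes\mathbb Q_p),\qquad \Gamma_{\mathcal H_p}=\mathrm{Aut}_{\mathbb Z_p}(\mathcal H\otimes\mathbb Z_p)$$ (endomorphisms and automorphisms of Lie algebras). Let $\widehat\Gamma_{\mathcal H}=\prod_p\Gamma_{\mathcal H_p}$, let $\widehat\Delta_{\mathcal H}$ be the set of $(\alpha_p)_p\in\prod_p\Delta_{\mathcal H_p}$ with $\alpha_p\in\Gamma_{\mathcal H_p}$ for almost all $p$, and let $\eta_{\mathcal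 H}:\Delta_{\mathcal H}\to\widehat\Delta_{\mathcal H}$ be the diagonal embedding. Regard $\Delta_{\mathcal H_p}$ as a subset of $\widehat\Delta_{\mathcal H}$ by taking the components at all primes other than $p$ to be the identity. Let $R_{\mathcal H}$ and $\widehat R_{\mathcal H}$ be the Hecke rings of $(\Gamma_{\mathcal H},\Delta_{\mathcal H})$ and $(\widehat\Gamma_{\mathcal H},\widehat\Delta_{\mathcal H})$, that is, additively, the free abelian groups on the double cosets $\Gamma_{\mathcal H}\backslash\Delta_{\mathcal H}/\Gamma_{\mathcal H}$ and $\widehat\Gamma_{\mathcal H}\backslash\widehat\Delta_{\mathcal H}/\widehat\Gamma_{\mathcal H}$. Then: 1. For each prime number $p$ there exists $\widehat\alpha\in\Delta_{\mathcal H_p}$ such that the set $\Gamma_{\mathcal H}\backslash\eta_{\mathcal H}^{-1}(\widehat\Gamma_{\mathcal H}\widehat\alpha\widehat\Gamma_{\mathcal H})/\Gamma_{\mathcal H}$ has more than one element. 2. For every $\widehat\alpha\in\widehat\Delta_{\mathcal H}$ the set $\Gamma_{\mathcal H}\backslash\eta_{\mathcal H}^{-1}(\widehat\Gamma_{\mathcal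 H}\widehat\alpha\widehat\Gamma_{\mathcal H})/\Gamma_{\mathcal H}$ is finite, and the additive map $$\eta_{\mathcal H}^*:\widehat R_{\mathcal H}\to R_{\mathcal H},\qquad \widehat\Gamma_{\mathcal H}\widehat\alpha\widehat\Gamma_{\mathcal H}\mapsto\sum \Gamma_{\mathcal H}\beta\Gamma_{\mathcal H},$$ where $\Gamma_{\mathcal H}\beta\Gamma_{\mathcal H}$ runs through that set, is not surjective. -/

import Mathlib

open scoped TensorProduct

noncomputable section

namespace LieHecke

/-- Lie algebra automorphisms form a group under composition. -/
instance lieAutGroup {R L : Type*} [CommRing R] [LieRing L] [LieAlgebra R L] :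
    Group (L ≃ₗ⁅R⁆ L) where
  mul f g := g.trans f
  one := 1
  inv f := f.symm
  mul_assoc _ _ _ := rfl
  one_mul _ := rfl
  mul_one _ := rfl
  inv_mul_cancel f := LieEquiv.self_trans_symm f

instance factPrime (p : Nat.Primes) : Fact p.1.Prime := ⟨p.2⟩

section Lattices

variable (k R K L : Type*) [CommRing k] [CommRing R] [CommRing K] [Algebra k R] [Algebra k K]
  [Algebra R K] [IsScalarTower k R K] [LieRing L] [LieAlgebra k L]

/-- `Aut_K (L ⊗ K)`, the automorphisms of the `K`-Lie algebra `L ⊗ K`. -/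
abbrev AutExt : Type _ := (K ⊗[k] L) ≃ₗ⁅K⁆ (K ⊗[k] L)

/-- The canonical map `L ⊗ R → L ⊗ K`. -/
def scalarMap : (R ⊗[k] L) →ₗ⁅k⁆ (K ⊗[k] L) :=
  LieAlgebra.ExtendScalars.map (IsScalarTower.toAlgHom k R K) LieHom.id

/-- `End_R (L ⊗ R) ∩ Aut_K (L ⊗ K)`: the automorphisms of `L ⊗ K` which are extensions of
endomorphisms of the `R`-Lie algebra `L ⊗ R`. -/
def integralEnd : Submonoid (AutExt k K L) where
  carrier := {g | ∃ φ : (R ⊗[k] L) →ₗ⁅R⁆ (R ⊗[k] L),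
    ∀ x, g (scalarMap k R K L x) = scalarMap k R K L (φ x)}
  one_mem' := ⟨LieHom.id, fun _ => rfl⟩
  mul_mem' := by
    rintro g h ⟨φ, hφ⟩ ⟨ψ, hψ⟩
    refine ⟨φ.comp ψ, fun x => ?_⟩
    change g (h _) = _
    rw [hψ, hφ]
    rfl

/-- `Aut_R (L ⊗ R)` as a subgroup of `Aut_K (L ⊗ K)`: the automorphisms of `L ⊗ K` which are
extensions of automorphisms of the `R`-Lie algebra `L ⊗ R`. -/
def integralAut : Subgroup (AutExt k K L) where
  carrier := {g | ∃ φ : (R ⊗[k] L) ≃ₗ⁅R⁆ (R ⊗[k] L),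
    ∀ x, g (scalarMap k R K L x) = scalarMap k R K L (φ x)}
  one_mem' := ⟨1, fun _ => rfl⟩
  mul_mem' := by
    rintro g h ⟨φ, hφ⟩ ⟨ψ, hψ⟩
    refine ⟨φ * ψ, fun x => ?_⟩
    change g (h _) = _
    rw [hψ, hφ]
    rfl
  inv_mem' := by
    rintro g ⟨φ, hφ⟩
    refine ⟨φ⁻¹, fun x => ?_⟩
    change g.symm _ = scalarMap k R K L (φ.symm x)
    rw [LieEquiv.symm_apply_eq, hφ, LieEquiv.apply_symm_apply]

end Lattices

section BaseChange

variable (k A B L : Type*) [CommRing k] [CommRing A] [CommRing B] [Algebra k A] [Algebra k B]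
  [Algebra A B] [IsScalarTower k A B] [LieRing L] [LieAlgebra k L]

/-- The `B`-linear extension to `L ⊗ B` of an `A`-linear endomorphism `f` of `L ⊗ A`: the unique
`B`-linear map sending `x ⊗ 1` to the image of `f (x ⊗ 1)`. In terms of a basis of `L` it has the
same matrix as `f`. -/
def extendLinear (f : (A ⊗[k] L) →ₗ[A] (A ⊗[k] L)) : (B ⊗[k] L) →ₗ[B] (B ⊗[k] L) :=
  LinearMap.liftBaseChange B
    ((scalarMap k A B L : (A ⊗[k] L) →ₗ[k] (B ⊗[k] L)) ∘ₗ f.restrictScalars k ∘ₗ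
      TensorProduct.mk k A L 1)

theorem scalarMap_tmul (a : A) (x : L) :
    scalarMap k A B L (a ⊗ₜ x) = algebraMap A B a ⊗ₜ x := rfl

theorem scalarMap_smul (a : A) (x : A ⊗[k] L) :
    scalarMap k A B L (a • x) = algebraMap A B a • scalarMap k A B L x := by
  induction x with
  | zero => simp
  | tmul b y =>
    rw [TensorProduct.smul_tmul', scalarMap_tmul, scalarMap_tmul, TensorProduct.smul_tmul',
      smul_eq_mul, smul_eq_mul, map_mul]
  | add x y hx hy => simp only [smul_add, map_add, hx, hy]

theorem extendLinear_tmul (f : (A ⊗[k] L) →ₗ[A] (A ⊗[k] L)) (b : B) (x : L) :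
    extendLinear k A B L f (b ⊗ₜ x) = b • scalarMap k A B L (f (1 ⊗ₜ x)) := by
  simp [extendLinear]

theorem extendLinear_scalarMap (f : (A ⊗[k] L) →ₗ[A] (A ⊗[k] L)) (x : A ⊗[k] L) :
    extendLinear k A B L f (scalarMap k A B L x) = scalarMap k A B L (f x) := by
  induction x with
  | zero => simp
  | tmul a y =>
    rw [scalarMap_tmul, extendLinear_tmul, ← scalarMap_smul, ← map_smul, TensorProduct.smul_tmul',
      smul_eq_mul, mul_one]
  | add x y hx hy => simp only [map_add, hx, hy]

theorem extendLinear_comp (f g : (A ⊗[k] L) →ₗ[A] (A ⊗[k] L)) (x : B ⊗[k] L) :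
    extendLinear k A B L f (extendLinear k A B L g x) = extendLinear k A B L (f ∘ₗ g) x := by
  induction x with
  | zero => simp
  | tmul b y => simp only [extendLinear_tmul, map_smul, extendLinear_scalarMap, LinearMap.comp_apply]
  | add x y hx hy => simp only [map_add, hx, hy]

theorem extendLinear_id (x : B ⊗[k] L) : extendLinear k A B L LinearMap.id x = x := by
  induction x with
  | zero => simp
  | tmul b y => simp [extendLinear_tmul, scalarMap_tmul, TensorProduct.smul_tmul']
  | add x y hx hy => simp only [map_add, hx, hy]

theorem extendLinear_lie (f : (A ⊗[k] L) →ₗ⁅A⁆ (A ⊗[k] L)) (x y : B ⊗[k] L) :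
    extendLinear k A B L f ⁅x, y⁆ = ⁅extendLinear k A B L f x, extendLinear k A B L f y⁆ := by
  induction x with
  | zero => simp
  | add x x' hx hx' => simp only [add_lie, map_add, hx, hx']
  | tmul b u =>
    induction y with
    | zero => simp
    | add y y' hy hy' => simp only [lie_add, map_add, hy, hy']
    | tmul c v =>
      have h : (1 : A) ⊗ₜ[k] ⁅u, v⁆ = ⁅(1 : A) ⊗ₜ[k] u, (1 : A) ⊗ₜ[k] v⁆ := by
        rw [LieAlgebra.ExtendScalars.bracket_tmul, mul_one]
      rw [LieAlgebra.ExtendScalars.bracket_tmul]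
      simp only [extendLinear_tmul, LieHom.coe_toLinearMap, h, LieHom.map_lie, smul_lie, lie_smul,
        smul_smul, mul_comm b c]

/-- Extension of scalars `Aut_A (L ⊗ A) → Aut_B (L ⊗ B)`. -/
def extendAut : AutExt k A L →* AutExt k B L where
  toFun g :=
    { toFun := extendLinear k A B L (g : (A ⊗[k] L) →ₗ⁅A⁆ (A ⊗[k] L))
      map_add' := map_add _
      map_smul' := map_smul _
      map_lie' := extendLinear_lie k A B L _ _ _
      invFun := extendLinear k A B L (g.symm : (A ⊗[k] L) →ₗ⁅A⁆ (A ⊗[k] L))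
      left_inv := fun x => by
        rw [extendLinear_comp]
        convert extendLinear_id k A B L x using 2
        congr 1
        ext y
        simp
      right_inv := fun x => by
        rw [extendLinear_comp]
        convert extendLinear_id k A B L x using 2
        congr 1
        ext y
        simp }
  map_one' := LieEquiv.ext fun x => extendLinear_id k A B L x
  map_mul' f g := LieEquiv.ext fun x => (extendLinear_comp k A B L _ _ x).symm

end BaseChange

section Hecke

variable (L : Type*) [LieRing L] [LieAlgebra ℤ L]

/-- `Δ_L = End(L) ∩ Aut(L ⊗ ℚ)`. -/
abbrev Δ : Submonoid (AutExt ℤ ℚ L) := integralEnd ℤ ℤ ℚ L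

/-- `Γ_L = Aut(L)`. -/
abbrev Γ : Subgroup (AutExt ℤ ℚ L) := integralAut ℤ ℤ ℚ L

/-- `Δ_{L_p} = End(L ⊗ ℤ_p) ∩ Aut(L ⊗ ℚ_p)`. -/
abbrev Δloc (p : Nat.Primes) : Submonoid (AutExt ℤ ℚ_[p] L) := integralEnd ℤ ℤ_[p] ℚ_[p] L

/-- `Γ_{L_p} = Aut(L ⊗ ℤ_p)`. -/
abbrev Γloc (p : Nat.Primes) : Subgroup (AutExt ℤ ℚ_[p] L) := integralAut ℤ ℤ_[p] ℚ_[p] L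

/-- The full product of the local groups `Aut(L ⊗ ℚ_p)` over all primes `p`. -/
abbrev GProd : Type _ := ∀ p : Nat.Primes, AutExt ℤ ℚ_[p] L

/-- The restricted product `Ĝ_L` of the groups `Aut(L ⊗ ℚ_p)` with respect to the `Γ_{L_p}`. -/
def Ghat : Subgroup (GProd L) where
  carrier := {x | ∀ᶠ p in Filter.cofinite, x p ∈ Γloc L p}
  one_mem' := by
    change ∀ᶠ p in Filter.cofinite, (1 : GProd L) p ∈ Γloc L p
    exact Filter.Eventually.of_forall fun p => (Γloc L p).one_mem
  mul_mem' {x y} hx hy := by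
    change ∀ᶠ p in Filter.cofinite, (x * y) p ∈ Γloc L p
    filter_upwards [hx, hy] with p hxp hyp using (Γloc L p).mul_mem hxp hyp
  inv_mem' {x} hx := by
    change ∀ᶠ p in Filter.cofinite, x⁻¹ p ∈ Γloc L p
    filter_upwards [hx] with p hxp using (Γloc L p).inv_mem hxp

/-- `Δ̂_L = (∏ Δ_{L_p}) ∩ Ĝ_L`. -/
def Δhat : Submonoid (GProd L) :=
  Submonoid.pi Set.univ (Δloc L) ⊓ (Ghat L).toSubmonoid

/-- `Γ̂_L = ∏ Γ_{L_p}`. -/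
def Γhat : Subgroup (GProd L) := Subgroup.pi Set.univ (Γloc L)

/-- The diagonal embedding `η_L` of `Δ_L` into `∏ Aut(L ⊗ ℚ_p)`. -/
def eta : Δ L →* GProd L :=
  (MonoidHom.pi fun p : Nat.Primes => extendAut ℤ ℚ ℚ_[p] L).comp (Δ L).subtype

/-- The inclusion of `Aut(L ⊗ ℚ_p)`, hence of `Δ_{L_p}`, into the product, with trivial components
at the other primes. -/
def ofLocal (p : Nat.Primes) : AutExt ℤ ℚ_[p] L →* GProd L :=
  MonoidHom.mulSingle (fun q : Nat.Primes => AutExt ℤ ℚ_[q] L) p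

/-- The set of double cosets `Γ_L \ η_L⁻¹(Γ̂_L α Γ̂_L) / Γ_L`. -/
def cosetsOver (α : GProd L) : Set (HeckeCoset (Δ L) (Γ L) (Γ L)) :=
  HeckeCoset.mk (Γ L) (Γ L) '' (eta L ⁻¹' DoubleCoset.doubleCoset α (Γhat L) (Γhat L))

/-- `Γ_L \ η_L⁻¹(D) / Γ_L` for a double coset `D` in `Γ̂_L \ Δ̂_L / Γ̂_L`. -/
def fiber (D : HeckeCoset (Δhat L) (Γhat L) (Γhat L)) : Set (HeckeCoset (Δ L) (Γ L) (Γ L)) :=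
  Quotient.lift (fun α : Δhat L => cosetsOver L α)
    (fun a b (h : DoubleCoset.doubleCoset (a : GProd L) (Γhat L) (Γhat L) =
        DoubleCoset.doubleCoset (b : GProd L) (Γhat L) (Γhat L)) => by
      simp only [cosetsOver, h]) D

/-- The additive map `η_L^* : R̂_L → R_L` which sends a double coset `D` to the sum of the double
cosets in `Γ_L \ η_L⁻¹(D) / Γ_L` (a `finsum`, so it is meaningful when these sets are finite). -/
def etaStar : HeckeRing (Δhat L) (Γhat L) ℤ →+ HeckeRing (Δ L) (Γ L) ℤ :=
  (Finsupp.liftAddHom fun D : HeckeCoset (Δhat L) (Γhat L) (Γhat L) =>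
    zmultiplesHom (HeckeRing (Δ L) (Γ L) ℤ)
      (∑ᶠ E ∈ fiber L D, HeckeCosetModule.of (Finsupp.single E 1)) :
    (HeckeCoset (Δhat L) (Γhat L) (Γhat L) →₀ ℤ) →+ HeckeRing (Δ L) (Γ L) ℤ)

end Hecke

/-- The Heisenberg Lie algebra: the quotient of the free Lie algebra `F` over `ℤ` on two
generators by the ideal `[F, [F, F]]`. -/
abbrev Heisenberg : Type :=
  FreeLieAlgebra ℤ (Fin 2) ⧸
    (⁅(⊤ : LieIdeal ℤ (FreeLieAlgebra ℤ (Fin 2))),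
      ⁅(⊤ : LieIdeal ℤ (FreeLieAlgebra ℤ (Fin 2))), (⊤ : LieIdeal ℤ (FreeLieAlgebra ℤ (Fin 2)))⁆⁆ :
      LieIdeal ℤ (FreeLieAlgebra ℤ (Fin 2)))

end LieHecke

end

/-!
In a basis of `L` the elements of `Δ L` are integral matrices with nonzero determinant, and those of
`Γ L` are the ones that are invertible over `ℤ`. The local double cosets determine the determinant
up to sign, and elements with associated determinant `d` whose matrices agree modulo `d` differ by
an element of `Γ L`; this gives finiteness.

For the Heisenberg algebra, an endomorphism acts on the centre by the determinant of its action on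
the abelianization. The rows of the matrices `W u = witness p u` are `(p³, 0, 0)`, `(0, p⁹, 0)` and
`(1, p³u, p¹²)`. Conjugation by `diag(u, 1, u)` turns `W 1` into `W u` when `u` is a unit, as is
`1 + p` in `ℤ_p`. On the other hand, `P * W 1 = W u * Q` forces `P 2 2`, `P 0 0 * P 1 1`, `P 0 0`
and `u * P 1 1` to coincide modulo `p³`, so that `u` is congruent to the unit `P 2 2`. Over `ℤ` this
means `u ≡ ±1`, which fails for `u = 1 + p`; the exponent `3` makes this true for `p = 2` as well.

The map `η*` cannot separate two cosets that lie over the same double coset of `Γ̂`, so it is not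
surjective as soon as there are two such cosets.
-/

noncomputable section

namespace LieHecke

section IntegralExtension

variable {k R K R' K' L : Type*} [CommRing k] [CommRing R] [CommRing K] [CommRing R'] [CommRing K']
  [Algebra k R] [Algebra k K] [Algebra k R'] [Algebra k K'] [Algebra R K] [Algebra R R']
  [Algebra R' K'] [Algebra K K'] [Algebra R K'] [IsScalarTower k R K] [IsScalarTower k R R']
  [IsScalarTower k R' K'] [IsScalarTower k K K'] [IsScalarTower R K K'] [IsScalarTower R R' K']
  [LieRing L] [LieAlgebra k L]

theorem scalarMap_scalarMap_eq (x : R ⊗[k] L) :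
    scalarMap k R' K' L (scalarMap k R R' L x) = scalarMap k K K' L (scalarMap k R K L x) := by
  induction x with
  | zero => simp
  | tmul r y =>
    simp only [scalarMap_tmul, ← IsScalarTower.algebraMap_apply R R' K',
      ← IsScalarTower.algebraMap_apply R K K']
  | add x y hx hy => simp only [map_add, hx, hy]

theorem extendLinear_scalarMap_of_comm {f : (K ⊗[k] L) →ₗ[K] (K ⊗[k] L)}
    {φ : (R ⊗[k] L) →ₗ[R] (R ⊗[k] L)}
    (h : ∀ x, f (scalarMap k R K L x) = scalarMap k R K L (φ x)) (x : R' ⊗[k] L) :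
    extendLinear k K K' L f (scalarMap k R' K' L x) =
      scalarMap k R' K' L (extendLinear k R R' L φ x) := by
  induction x with
  | zero => simp
  | tmul r y =>
    have hy : f (1 ⊗ₜ y) = scalarMap k R K L (φ (1 ⊗ₜ y)) := by
      rw [← h, scalarMap_tmul, map_one]
    rw [scalarMap_tmul, extendLinear_tmul, extendLinear_tmul, scalarMap_smul, hy,
      scalarMap_scalarMap_eq (R' := R') (K := K)]
  | add x y hx hy => simp only [map_add, hx, hy]

theorem extendAut_mem_integralEnd {g : AutExt k K L} (hg : g ∈ integralEnd k R K L) :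
    extendAut k K K' L g ∈ integralEnd k R' K' L := by
  obtain ⟨φ, hφ⟩ := hg
  refine ⟨{ extendLinear k R R' L φ with map_lie' := extendLinear_lie k R R' L φ _ _ },
    extendLinear_scalarMap_of_comm hφ⟩

theorem extendAut_mem_integralAut {g : AutExt k K L} (hg : g ∈ integralAut k R K L) :
    extendAut k K K' L g ∈ integralAut k R' K' L := by
  obtain ⟨φ, hφ⟩ := hg
  exact ⟨extendAut k R R' L φ, extendLinear_scalarMap_of_comm hφ⟩

end IntegralExtension

section HeckeCosets

variable {L : Type*} [LieRing L] [LieAlgebra ℤ L]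

theorem eta_apply (β : Δ L) (p : Nat.Primes) : eta L β p = extendAut ℤ ℚ ℚ_[p] L β := rfl

theorem eta_mem_Δloc (β : Δ L) (p : Nat.Primes) : eta L β p ∈ Δloc L p :=
  extendAut_mem_integralEnd (R := ℤ) β.2

theorem extendAut_mem_Γloc {x : AutExt ℤ ℚ L} (hx : x ∈ Γ L) (p : Nat.Primes) :
    extendAut ℤ ℚ ℚ_[p] L x ∈ Γloc L p :=
  extendAut_mem_integralAut (R := ℤ) hx

theorem heckeCoset_mk_eq_mk_iff {β β' : Δ L} :
    HeckeCoset.mk (Γ L) (Γ L) β = HeckeCoset.mk (Γ L) (Γ L) β' ↔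
      ∃ x ∈ Γ L, ∃ y ∈ Γ L, (β' : AutExt ℤ ℚ L) = x * β * y :=
  Quotient.eq.trans DoubleCoset.rel_iff

theorem mem_doubleCoset_Γhat_iff {α α' : GProd L} :
    α' ∈ DoubleCoset.doubleCoset α (Γhat L) (Γhat L) ↔
      ∀ p, ∃ x ∈ Γloc L p, ∃ y ∈ Γloc L p, α' p = x * α p * y := by
  rw [DoubleCoset.mem_doubleCoset]
  constructor
  · rintro ⟨x, hx, y, hy, rfl⟩ p
    exact ⟨x p, hx p trivial, y p, hy p trivial, rfl⟩
  · intro h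
    choose x hx y hy hxy using h
    exact ⟨x, fun p _ => hx p, y, fun p _ => hy p, funext hxy⟩

theorem eta_mem_doubleCoset_of_mk_eq_mk {β β' : Δ L}
    (h : HeckeCoset.mk (Γ L) (Γ L) β = HeckeCoset.mk (Γ L) (Γ L) β') :
    eta L β' ∈ DoubleCoset.doubleCoset (eta L β) (Γhat L) (Γhat L) := by
  obtain ⟨x, hx, y, hy, hxy⟩ := heckeCoset_mk_eq_mk_iff.1 h
  refine mem_doubleCoset_Γhat_iff.2 fun p =>
    ⟨_, extendAut_mem_Γloc hx p, _, extendAut_mem_Γloc hy p, ?_⟩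
  rw [eta_apply, hxy, map_mul, map_mul, eta_apply]

theorem mk_mem_cosetsOver_iff {α : GProd L} {β : Δ L} :
    HeckeCoset.mk (Γ L) (Γ L) β ∈ cosetsOver L α ↔
      eta L β ∈ DoubleCoset.doubleCoset α (Γhat L) (Γhat L) := by
  refine ⟨?_, fun h => ⟨β, h, rfl⟩⟩
  rintro ⟨β', hβ', h⟩
  rw [← DoubleCoset.doubleCoset_eq_of_mem hβ']
  exact eta_mem_doubleCoset_of_mk_eq_mk h

theorem mem_fiber_iff_of_mem_cosetsOver {α : GProd L} {E E' : HeckeCoset (Δ L) (Γ L) (Γ L)}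
    (hE : E ∈ cosetsOver L α) (hE' : E' ∈ cosetsOver L α)
    (D : HeckeCoset (Δhat L) (Γhat L) (Γhat L)) : E ∈ fiber L D ↔ E' ∈ fiber L D := by
  obtain ⟨β, hβ, rfl⟩ := hE
  obtain ⟨β', hβ', rfl⟩ := hE'
  induction D using Quotient.inductionOn with
  | h δ =>
    have mem_iff {β : Δ L} (hβ : eta L β ∈ DoubleCoset.doubleCoset α (Γhat L) (Γhat L)) :
        HeckeCoset.mk (Γ L) (Γ L) β ∈ cosetsOver L (δ : GProd L) ↔
          DoubleCoset.doubleCoset α (Γhat L) (Γhat L) =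
            DoubleCoset.doubleCoset (δ : GProd L) (Γhat L) (Γhat L) := by
      rw [mk_mem_cosetsOver_iff, ← DoubleCoset.doubleCoset_eq_of_mem hβ]
      exact ⟨DoubleCoset.doubleCoset_eq_of_mem,
        fun h => h ▸ DoubleCoset.mem_doubleCoset_self _ _ _⟩
    exact (mem_iff hβ).trans (mem_iff hβ').symm

theorem finsum_mem_single_apply_congr {s : Set (HeckeCoset (Δ L) (Γ L) (Γ L))}
    {E E' : HeckeCoset (Δ L) (Γ L) (Γ L)} (h : E ∈ s ↔ E' ∈ s) :
    (∑ᶠ X ∈ s, HeckeCosetModule.of (Finsupp.single X 1) : HeckeRing (Δ L) (Γ L) ℤ) E =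
      (∑ᶠ X ∈ s, HeckeCosetModule.of (Finsupp.single X 1) : HeckeRing (Δ L) (Γ L) ℤ) E' := by
  classical
  by_cases hs : s.Finite
  · have apply_eq (X : HeckeCoset (Δ L) (Γ L) (Γ L)) :
        (∑ᶠ Y ∈ s, HeckeCosetModule.of (Finsupp.single Y 1) : HeckeRing (Δ L) (Γ L) ℤ) X =
          if X ∈ s then 1 else 0 := by
      rw [finsum_mem_eq_finite_toFinset_sum _ hs]
      change (∑ Y ∈ hs.toFinset, (Finsupp.single Y 1 : _ →₀ ℤ)) X = _
      simp [Finsupp.finsetSum_apply, Finsupp.single_apply]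
    simp only [apply_eq, h]
  · have support_eq : s ∩ Function.support (fun X => (HeckeCosetModule.of (Finsupp.single X 1) :
        HeckeRing (Δ L) (Γ L) ℤ)) = s :=
      Set.inter_eq_left.2 fun X _ => Finsupp.single_ne_zero.2 one_ne_zero
    rw [finsum_mem_eq_zero_of_infinite (by rwa [support_eq])]
    rfl

theorem etaStar_apply_congr {E E' : HeckeCoset (Δ L) (Γ L) (Γ L)}
    (h : ∀ D, E ∈ fiber L D ↔ E' ∈ fiber L D) (z : HeckeRing (Δhat L) (Γhat L) ℤ) :
    etaStar L z E = etaStar L z E' := by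
  let eval (X : HeckeCoset (Δ L) (Γ L) (Γ L)) : HeckeRing (Δ L) (Γ L) ℤ →+ ℤ :=
    Finsupp.applyAddHom X
  suffices eval_comp_eq : (eval E).comp (etaStar L) = (eval E').comp (etaStar L) from
    DFunLike.congr_fun eval_comp_eq z
  refine Finsupp.addHom_ext fun D n => ?_
  have eval_etaStar (X : HeckeCoset (Δ L) (Γ L) (Γ L)) :
      eval X (etaStar L (Finsupp.single D n)) =
        n • eval X (∑ᶠ Y ∈ fiber L D, HeckeCosetModule.of (Finsupp.single Y 1)) := by
    change eval X (Finsupp.liftAddHom _ (Finsupp.single D n)) = _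
    rw [Finsupp.liftAddHom_apply_single, zmultiplesHom_apply, map_zsmul]
  exact (eval_etaStar E).trans <| (congrArg (n • ·) (finsum_mem_single_apply_congr (h D))).trans
    (eval_etaStar E').symm

theorem not_surjective_etaStar_of_one_lt_encard {α : GProd L}
    (h : 1 < (cosetsOver L α).encard) : ¬ Function.Surjective (etaStar L) := by
  intro surj
  obtain ⟨E, E', hE, hE', hne⟩ := Set.one_lt_encard_iff.1 h
  obtain ⟨z, hz⟩ := surj (HeckeCosetModule.of (Finsupp.single E 1))
  have apply_eq := etaStar_apply_congr (mem_fiber_iff_of_mem_cosetsOver hE hE') z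
  rw [hz, HeckeCosetModule.of_apply, HeckeCosetModule.of_apply, Finsupp.single_eq_same,
    Finsupp.single_eq_of_ne hne.symm] at apply_eq
  exact one_ne_zero apply_eq

end HeckeCosets

section AutMatrix

variable {k R K L ι : Type*} [CommRing k] [CommRing R] [CommRing K] [Algebra k R] [Algebra k K]
  [Algebra R K] [IsScalarTower k R K] [LieRing L] [LieAlgebra k L] (b : Module.Basis ι k L)

theorem basis_repr_scalarMap (x : R ⊗[k] L) (i : ι) :
    (Algebra.TensorProduct.basis K b).repr (scalarMap k R K L x) i =
      algebraMap R K ((Algebra.TensorProduct.basis R b).repr x i) := by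
  induction x with
  | zero => simp
  | tmul r y =>
    simp only [scalarMap_tmul, Algebra.TensorProduct.basis_repr_tmul, Finsupp.smul_apply,
      Finsupp.mapRange_apply, smul_eq_mul, map_mul, ← IsScalarTower.algebraMap_apply]
  | add x y hx hy => simp only [map_add, Finsupp.add_apply, hx, hy]

include b in
theorem scalarMap_injective (hRK : Function.Injective (algebraMap R K)) :
    Function.Injective (scalarMap k R K L) := fun x y hxy =>
  (Algebra.TensorProduct.basis R b).ext_elem fun i => hRK <| by
    rw [← basis_repr_scalarMap, ← basis_repr_scalarMap, hxy]

variable [Fintype ι] [DecidableEq ι]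

theorem toMatrix_extendLinear (φ : (R ⊗[k] L) →ₗ[R] (R ⊗[k] L)) :
    LinearMap.toMatrix (Algebra.TensorProduct.basis K b) (Algebra.TensorProduct.basis K b)
        (extendLinear k R K L φ) =
      (LinearMap.toMatrix (Algebra.TensorProduct.basis R b) (Algebra.TensorProduct.basis R b)
        φ).map (algebraMap R K) := by
  ext i j
  rw [Matrix.map_apply, LinearMap.toMatrix_apply, LinearMap.toMatrix_apply,
    Algebra.TensorProduct.basis_apply, Algebra.TensorProduct.basis_apply, extendLinear_tmul,
    one_smul, basis_repr_scalarMap]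

variable (K) in
/-- The matrix of an automorphism of `L ⊗ K` in the basis induced by a basis `b` of `L`. -/
def autMatrix : AutExt k K L →* Matrix ι ι K where
  toFun g := LinearMap.toMatrix (Algebra.TensorProduct.basis K b) (Algebra.TensorProduct.basis K b)
    (g.toLinearEquiv : (K ⊗[k] L) →ₗ[K] (K ⊗[k] L))
  map_one' := LinearMap.toMatrix_id _
  map_mul' _ _ := LinearMap.toMatrix_comp _ _ _ _ _

theorem autMatrix_injective : Function.Injective (autMatrix (k := k) (L := L) K b) :=
  fun _ _ h => LieEquiv.ext fun x =>
    LinearMap.congr_fun ((LinearMap.toMatrix _ _).injective h) x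

theorem autMatrix_extendAut (g : AutExt k R L) :
    autMatrix K b (extendAut k R K L g) = (autMatrix R b g).map (algebraMap R K) :=
  toMatrix_extendLinear b _

theorem isUnit_autMatrix (g : AutExt k K L) : IsUnit (autMatrix K b g) :=
  (Group.isUnit g).map _

theorem autMatrix_eq_map_toMatrix_iff {g : AutExt k K L} {φ : (R ⊗[k] L) →ₗ[R] (R ⊗[k] L)} :
    autMatrix K b g = (LinearMap.toMatrix (Algebra.TensorProduct.basis R b)
        (Algebra.TensorProduct.basis R b) φ).map (algebraMap R K) ↔
      ∀ x, g (scalarMap k R K L x) = scalarMap k R K L (φ x) := by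
  rw [← toMatrix_extendLinear]
  refine (LinearMap.toMatrix _ _).injective.eq_iff.trans ⟨fun h x => ?_, fun h => ?_⟩
  · exact (LinearMap.congr_fun h _).trans (extendLinear_scalarMap k R K L φ x)
  · refine TensorProduct.AlgebraTensorModule.curry_injective
      (LinearMap.ext_ring (LinearMap.ext fun y => ?_))
    have apply_tmul := h (1 ⊗ₜ y)
    rw [scalarMap_tmul, map_one] at apply_tmul
    change g (1 ⊗ₜ y) = extendLinear k R K L φ (1 ⊗ₜ y)
    rw [apply_tmul, extendLinear_tmul, one_smul]

theorem mem_integralEnd_iff (hRK : Function.Injective (algebraMap R K)) {g : AutExt k K L} :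
    g ∈ integralEnd k R K L ↔
      ∃ P : Matrix ι ι R, autMatrix K b g = P.map (algebraMap R K) := by
  constructor
  · rintro ⟨φ, hφ⟩
    exact ⟨_, (autMatrix_eq_map_toMatrix_iff b (φ := φ)).2 hφ⟩
  · rintro ⟨P, hP⟩
    obtain ⟨φ, rfl⟩ := (LinearMap.toMatrix (Algebra.TensorProduct.basis R b)
      (Algebra.TensorProduct.basis R b)).surjective P
    rw [autMatrix_eq_map_toMatrix_iff] at hP
    have map_lie (x y : R ⊗[k] L) : φ ⁅x, y⁆ = ⁅φ x, φ y⁆ :=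
      scalarMap_injective b hRK <| by rw [← hP, LieHom.map_lie, LieEquiv.map_lie, hP, hP,
        LieHom.map_lie]
    exact ⟨{ φ with map_lie' := map_lie _ _ }, hP⟩

theorem mem_integralAut_iff (hRK : Function.Injective (algebraMap R K)) {g : AutExt k K L} :
    g ∈ integralAut k R K L ↔
      ∃ P : Matrix ι ι R, IsUnit P.det ∧ autMatrix K b g = P.map (algebraMap R K) := by
  constructor
  · rintro ⟨φ, hφ⟩
    let ψ : (R ⊗[k] L) ≃ₗ[R] (R ⊗[k] L) := φ.toLinearEquiv
    exact ⟨_, LinearEquiv.isUnit_det ψ _ _,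
      (autMatrix_eq_map_toMatrix_iff b (φ := (ψ : (R ⊗[k] L) →ₗ[R] (R ⊗[k] L)))).2 hφ⟩
  · rintro ⟨P, P_unit, hP⟩
    obtain ⟨φ, hφ⟩ := (mem_integralEnd_iff b hRK).2 ⟨P, hP⟩
    have toMatrix_eq : LinearMap.toMatrix (Algebra.TensorProduct.basis R b)
        (Algebra.TensorProduct.basis R b) φ = P :=
      Matrix.map_injective hRK (((autMatrix_eq_map_toMatrix_iff b).2 hφ).symm.trans hP)
    have φ_bijective : Function.Bijective φ := (LinearEquiv.ofIsUnitDet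
      (v := Algebra.TensorProduct.basis R b) (v' := Algebra.TensorProduct.basis R b)
      (f := (φ : (R ⊗[k] L) →ₗ[R] (R ⊗[k] L))) (by rwa [toMatrix_eq])).bijective
    exact ⟨LieEquiv.ofBijective φ φ_bijective, hφ⟩

end AutMatrix

section Finiteness

theorem exists_isUnit_det_eq_mul_of_det_dvd_sub {ι R : Type*} [Fintype ι] [DecidableEq ι]
    [CommRing R] [IsDomain R] {M N : Matrix ι ι R} (hN : N.det ≠ 0)
    (hdet : Associated M.det N.det) (hsub : ∀ i j, N.det ∣ M i j - N i j) :
    ∃ P : Matrix ι ι R, IsUnit P.det ∧ M = P * N := by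
  choose X hX using hsub
  have eq_mul : M = (1 + Matrix.of X * N.adjugate) * N := by
    rw [add_mul, one_mul, mul_assoc, Matrix.adjugate_mul, Matrix.mul_smul, mul_one]
    ext i j
    rw [Matrix.add_apply, Matrix.smul_apply, Matrix.of_apply, smul_eq_mul, ← hX]
    ring
  refine ⟨_, isUnit_of_associated_mul (p := N.det) ?_ hN, eq_mul⟩
  rwa [mul_comm, ← Matrix.det_mul, ← eq_mul]

theorem int_dvd_of_forall_padic_norm_le {m n : ℤ}
    (h : ∀ p : Nat.Primes, ‖(n : ℚ_[p])‖ ≤ ‖(m : ℚ_[p])‖) : m ∣ n := by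
  refine Int.natAbs_dvd_natAbs.1 ((Nat.dvd_iff_prime_pow_dvd_dvd _ _).2 fun p k hp hk => ?_)
  have : Fact p.Prime := ⟨hp⟩
  rw [← Int.natCast_dvd, Nat.cast_pow, ← Padic.norm_int_le_pow_iff_dvd] at hk ⊢
  exact (h ⟨p, hp⟩).trans hk

variable {L ι : Type*} [LieRing L] [Fintype ι] [DecidableEq ι]
  (b : Module.Basis ι ℤ L)

/-- The matrix of an element of `Δ L`, regarded as an endomorphism of `L`, in a basis of `L`. -/
def intMatrix (β : Δ L) : Matrix ι ι ℤ :=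
  ((mem_integralEnd_iff b (algebraMap ℤ ℚ).injective_int).1 β.2).choose

theorem autMatrix_eq_map_intMatrix (β : Δ L) :
    autMatrix ℚ b β = (intMatrix b β).map (algebraMap ℤ ℚ) :=
  ((mem_integralEnd_iff b (algebraMap ℤ ℚ).injective_int).1 β.2).choose_spec

theorem intMatrix_eq_of_autMatrix_eq_map {β : Δ L} {P : Matrix ι ι ℤ}
    (h : autMatrix ℚ b β = P.map (algebraMap ℤ ℚ)) : intMatrix b β = P :=
  Matrix.map_injective (algebraMap ℤ ℚ).injective_int <|
    (autMatrix_eq_map_intMatrix b β).symm.trans h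

theorem autMatrix_eta (β : Δ L) (p : Nat.Primes) :
    autMatrix ℚ_[p] b (eta L β p) = (intMatrix b β).map (algebraMap ℤ ℚ_[p]) := by
  rw [eta_apply, autMatrix_extendAut, autMatrix_eq_map_intMatrix, Matrix.map_map,
    ← RingHom.coe_comp, ← IsScalarTower.algebraMap_eq]

theorem det_intMatrix_ne_zero (β : Δ L) : (intMatrix b β).det ≠ 0 := fun h => by
  have det_isUnit := (Matrix.isUnit_iff_isUnit_det _).1 (isUnit_autMatrix (K := ℚ) b β)
  rw [autMatrix_eq_map_intMatrix, ← RingHom.mapMatrix_apply, ← RingHom.map_det, h, map_zero]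
    at det_isUnit
  exact not_isUnit_zero det_isUnit

theorem heckeCoset_mk_eq_mk_of_intMatrix_eq_mul {β β' : Δ L} {P : Matrix ι ι ℤ}
    (hP : IsUnit P.det) (h : intMatrix b β' = P * intMatrix b β) :
    HeckeCoset.mk (Γ L) (Γ L) β = HeckeCoset.mk (Γ L) (Γ L) β' := by
  have autMatrix_mul_inv :
      autMatrix ℚ b (β' * (β : AutExt ℤ ℚ L)⁻¹) = P.map (algebraMap ℤ ℚ) := by
    refine (isUnit_autMatrix (K := ℚ) b β).mul_left_injective ?_
    change _ * _ = _ * _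
    rw [← map_mul, inv_mul_cancel_right, autMatrix_eq_map_intMatrix, autMatrix_eq_map_intMatrix, h,
      Matrix.map_mul]
  refine heckeCoset_mk_eq_mk_iff.2 ⟨_, (mem_integralAut_iff b
    (algebraMap ℤ ℚ).injective_int).2 ⟨P, hP, autMatrix_mul_inv⟩, 1, one_mem _, ?_⟩
  rw [mul_one, inv_mul_cancel_right]

theorem norm_det_autMatrix_of_mem_Γloc {p : Nat.Primes} {x : AutExt ℤ ℚ_[p] L}
    (hx : x ∈ Γloc L p) : ‖(autMatrix ℚ_[p] b x).det‖ = 1 := by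
  obtain ⟨P, hP, hxP⟩ := (mem_integralAut_iff b (IsFractionRing.injective _ _)).1 hx
  rw [hxP, ← RingHom.mapMatrix_apply, ← RingHom.map_det]
  exact PadicInt.isUnit_iff.1 hP

theorem norm_det_intMatrix_of_eta_mem {α : GProd L} {β : Δ L}
    (h : eta L β ∈ DoubleCoset.doubleCoset α (Γhat L) (Γhat L)) (p : Nat.Primes) :
    ‖((intMatrix b β).det : ℚ_[p])‖ = ‖(autMatrix ℚ_[p] b (α p)).det‖ := by
  obtain ⟨x, hx, y, hy, eta_eq⟩ := mem_doubleCoset_Γhat_iff.1 h p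
  calc ‖((intMatrix b β).det : ℚ_[p])‖ = ‖(autMatrix ℚ_[p] b (eta L β p)).det‖ := by
        rw [autMatrix_eta, ← RingHom.mapMatrix_apply, ← RingHom.map_det, eq_intCast]
    _ = ‖(autMatrix ℚ_[p] b (α p)).det‖ := by
        rw [eta_eq, map_mul, map_mul, Matrix.det_mul, Matrix.det_mul, norm_mul, norm_mul,
          norm_det_autMatrix_of_mem_Γloc b hx, norm_det_autMatrix_of_mem_Γloc b hy, one_mul,
          mul_one]

theorem associated_det_intMatrix {α : GProd L} {β β' : Δ L}
    (h : eta L β ∈ DoubleCoset.doubleCoset α (Γhat L) (Γhat L))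
    (h' : eta L β' ∈ DoubleCoset.doubleCoset α (Γhat L) (Γhat L)) :
    Associated (intMatrix b β).det (intMatrix b β').det := by
  have norm_eq (p : Nat.Primes) :=
    (norm_det_intMatrix_of_eta_mem b h p).trans (norm_det_intMatrix_of_eta_mem b h' p).symm
  exact associated_of_dvd_dvd (int_dvd_of_forall_padic_norm_le fun p => (norm_eq p).ge)
    (int_dvd_of_forall_padic_norm_le fun p => (norm_eq p).le)

end Finiteness

theorem cosetsOver_finite {L ι : Type*} [LieRing L] [Finite ι] (b : Module.Basis ι ℤ L)
    (α : GProd L) : (cosetsOver L α).Finite := by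
  classical
  cases nonempty_fintype ι
  obtain empty | ⟨-, β₀, hβ₀, -⟩ := (cosetsOver L α).eq_empty_or_nonempty
  · exact empty ▸ Set.finite_empty
  let N := (intMatrix b β₀).det.natAbs
  have : NeZero N := ⟨Int.natAbs_ne_zero.2 (det_intMatrix_ne_zero b β₀)⟩
  have mk_eq_mk {β β' : Δ L} (hβ : eta L β ∈ DoubleCoset.doubleCoset α (Γhat L) (Γhat L))
      (hβ' : eta L β' ∈ DoubleCoset.doubleCoset α (Γhat L) (Γhat L))
      (h : (intMatrix b β).map (Int.cast : ℤ → ZMod N) = (intMatrix b β').map Int.cast) :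
      HeckeCoset.mk (Γ L) (Γ L) β = HeckeCoset.mk (Γ L) (Γ L) β' := by
    have dvd_sub (i j : ι) : (intMatrix b β).det ∣ intMatrix b β' i j - intMatrix b β i j := by
      rw [(associated_det_intMatrix b hβ hβ₀).dvd_iff_dvd_left, ← Int.natAbs_dvd,
        ← ZMod.intCast_eq_intCast_iff_dvd_sub]
      exact congrFun₂ h i j
    obtain ⟨P, hP, eq_mul⟩ := exists_isUnit_det_eq_mul_of_det_dvd_sub
      (det_intMatrix_ne_zero b β) (associated_det_intMatrix b hβ' hβ) dvd_sub
    exact heckeCoset_mk_eq_mk_of_intMatrix_eq_mul b hP eq_mul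
  choose rep eta_rep_mem mk_rep using fun E : cosetsOver L α => E.2
  have : Finite (cosetsOver L α) := Finite.of_injective
    (fun E => (intMatrix b (rep E)).map (Int.cast : ℤ → ZMod N)) fun E E' h =>
      Subtype.ext <| by rw [← mk_rep E, ← mk_rep E', mk_eq_mk (eta_rep_mem E) (eta_rep_mem E') h]
  exact Set.toFinite _

section HeisenbergBases

theorem lie_smul_add_smul_of_central {K M : Type*} [CommRing K] [LieRing M]
    [LieAlgebra K M] {x y z : M} (hz : ∀ w : M, ⁅w, z⁆ = 0)
    (a b c a' b' c' : K) :
    ⁅a • x + b • y + c • z, a' • x + b' • y + c' • z⁆ = (a * b' - b * a') • ⁅x, y⁆ := by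
  have z_lie (w : M) : ⁅z, w⁆ = 0 := by rw [← lie_skew, hz, neg_zero]
  simp only [lie_add, add_lie, lie_smul, smul_lie, lie_self, hz, z_lie, ← lie_skew y x]
  module

/-- A basis `e₀, e₁, e₂` of a Lie algebra in which `e₂ = ⁅e₀, e₁⁆` is central: a choice of
Heisenberg coordinates. -/
structure HeisenbergBasis (K M : Type*) [CommRing K] [LieRing M] [LieAlgebra K M] where
  /-- The basis `e₀, e₁, e₂`. -/
  basis : Module.Basis (Fin 3) K M
  basis_two : basis 2 = ⁅basis 0, basis 1⁆
  lie_basis_two : ∀ i, ⁅basis i, basis 2⁆ = 0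

/-- The matrices of the endomorphisms of the Heisenberg Lie algebra in a Heisenberg basis: the
centre is preserved and acted upon by the determinant of the action on the abelianization. -/
def IsHeisenbergMatrix {R : Type*} [CommRing R] (P : Matrix (Fin 3) (Fin 3) R) : Prop :=
  P 0 2 = 0 ∧ P 1 2 = 0 ∧ P 2 2 = P 0 0 * P 1 1 - P 0 1 * P 1 0

theorem IsHeisenbergMatrix.map {R S : Type*} [CommRing R] [CommRing S]
    {P : Matrix (Fin 3) (Fin 3) R} (hP : IsHeisenbergMatrix P) (f : R →+* S) :
    IsHeisenbergMatrix (P.map f) := by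
  obtain ⟨h02, h12, h22⟩ := hP
  simp [IsHeisenbergMatrix, h02, h12, h22]

theorem isHeisenbergMatrix_map_iff {R S : Type*} [CommRing R] [CommRing S] {f : R →+* S}
    (hf : Function.Injective f) {P : Matrix (Fin 3) (Fin 3) R} :
    IsHeisenbergMatrix (P.map f) ↔ IsHeisenbergMatrix P := by
  simp only [IsHeisenbergMatrix, Matrix.map_apply, map_eq_zero_iff f hf, ← map_mul, ← map_sub,
    hf.eq_iff]

theorem IsHeisenbergMatrix.det_eq {R : Type*} [CommRing R] {P : Matrix (Fin 3) (Fin 3) R}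
    (hP : IsHeisenbergMatrix P) : P.det = P 2 2 ^ 2 := by
  obtain ⟨h02, h12, h22⟩ := hP
  rw [Matrix.det_fin_three, h02, h12, h22]
  ring

namespace HeisenbergBasis

variable {K M N : Type*} [CommRing K] [LieRing M] [LieAlgebra K M] [LieRing N] [LieAlgebra K N]
  (B : HeisenbergBasis K M)

theorem eq_smul_add_smul (u : M) :
    u = B.basis.repr u 0 • B.basis 0 + B.basis.repr u 1 • B.basis 1 +
      B.basis.repr u 2 • B.basis 2 := by
  rw [← Fin.sum_univ_three fun i => B.basis.repr u i • B.basis i, B.basis.sum_repr]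

theorem lie_basis_two_eq_zero (w : M) : ⁅w, B.basis 2⁆ = 0 := by
  rw [B.eq_smul_add_smul w]
  simp only [add_lie, smul_lie, B.lie_basis_two, smul_zero, add_zero]

theorem lie_eq_smul (u v : M) :
    ⁅u, v⁆ = (B.basis.repr u 0 * B.basis.repr v 1 - B.basis.repr u 1 * B.basis.repr v 0) •
      B.basis 2 := by
  conv_lhs => rw [B.eq_smul_add_smul u, B.eq_smul_add_smul v,
    lie_smul_add_smul_of_central B.lie_basis_two_eq_zero, ← B.basis_two]

theorem isHeisenbergMatrix_toMatrix_iff_apply_two {f : M →ₗ[K] M} :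
    IsHeisenbergMatrix (LinearMap.toMatrix B.basis B.basis f) ↔
      f (B.basis 2) = ⁅f (B.basis 0), f (B.basis 1)⁆ := by
  rw [B.lie_eq_smul, B.basis.ext_elem_iff]
  simp [Fin.forall_fin_succ, IsHeisenbergMatrix, LinearMap.toMatrix_apply, mul_comm]

theorem isHeisenbergMatrix_toMatrix_iff {f : M →ₗ[K] M} :
    IsHeisenbergMatrix (LinearMap.toMatrix B.basis B.basis f) ↔ ∀ u v, f ⁅u, v⁆ = ⁅f u, f v⁆ := by
  rw [B.isHeisenbergMatrix_toMatrix_iff_apply_two]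
  refine ⟨fun apply_two u v => ?_, fun map_lie => by rw [← map_lie, ← B.basis_two]⟩
  have apply_two_central (w : M) : ⁅w, f (B.basis 2)⁆ = 0 := by
    rw [apply_two, B.lie_eq_smul (f _), lie_smul, B.lie_basis_two_eq_zero, smul_zero]
  have apply_eq (w : M) := congrArg f (B.eq_smul_add_smul w)
  simp only [map_add, map_smul] at apply_eq
  rw [apply_eq u, apply_eq v, lie_smul_add_smul_of_central apply_two_central, B.lie_eq_smul u v,
    map_smul, apply_two]

include B in
theorem lie_lie_eq_zero (u v w : M) : ⁅u, ⁅v, w⁆⁆ = 0 := by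
  rw [B.lie_eq_smul v w, lie_smul, B.lie_basis_two_eq_zero, smul_zero]

/-- The image of a Heisenberg basis under an isomorphism of Lie algebras. -/
def map (e : M ≃ₗ⁅K⁆ N) : HeisenbergBasis K N where
  basis := B.basis.map e.toLinearEquiv
  basis_two := (congrArg e B.basis_two).trans (e.map_lie _ _)
  lie_basis_two i := (e.map_lie _ _).symm.trans <| (congrArg e (B.lie_basis_two i)).trans e.map_zero

/-- The homomorphism sending `e₀` to `x`, `e₁` to `y` and hence `e₂` to `⁅x, y⁆`. -/
def lift {x y : N} (h : ∀ w : N, ⁅w, ⁅x, y⁆⁆ = 0) : M →ₗ⁅K⁆ N :=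
  { B.basis.constr K ![x, y, ⁅x, y⁆] with
    map_lie' {u v} := by
      change B.basis.constr K ![x, y, ⁅x, y⁆] ⁅u, v⁆ =
        ⁅B.basis.constr K ![x, y, ⁅x, y⁆] u, B.basis.constr K ![x, y, ⁅x, y⁆] v⁆
      rw [B.lie_eq_smul, map_smul, Module.Basis.constr_basis]
      simp only [Module.Basis.constr_apply_fintype, Fin.sum_univ_three]
      exact (lie_smul_add_smul_of_central h _ _ _ _ _ _).symm }

theorem lift_basis_zero {x y : N} (h : ∀ w : N, ⁅w, ⁅x, y⁆⁆ = 0) : B.lift h (B.basis 0) = x :=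
  B.basis.constr_basis K _ 0

theorem lift_basis_one {x y : N} (h : ∀ w : N, ⁅w, ⁅x, y⁆⁆ = 0) : B.lift h (B.basis 1) = y :=
  B.basis.constr_basis K _ 1

/-- The Heisenberg basis `1 ⊗ e₀, 1 ⊗ e₁, 1 ⊗ e₂` of `K' ⊗ M`. -/
def baseChange (K' : Type*) [CommRing K'] [Algebra K K'] : HeisenbergBasis K' (K' ⊗[K] M) where
  basis := Algebra.TensorProduct.basis K' B.basis
  basis_two := by
    simp only [Algebra.TensorProduct.basis_apply, LieAlgebra.ExtendScalars.bracket_tmul, mul_one,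
      B.basis_two]
  lie_basis_two i := by
    rw [Algebra.TensorProduct.basis_apply, Algebra.TensorProduct.basis_apply,
      LieAlgebra.ExtendScalars.bracket_tmul, B.lie_basis_two, TensorProduct.tmul_zero]

theorem isHeisenbergMatrix_autMatrix {K' : Type*} [CommRing K'] [Algebra K K']
    (g : AutExt K K' M) : IsHeisenbergMatrix (autMatrix K' B.basis g) :=
  (B.baseChange K').isHeisenbergMatrix_toMatrix_iff.2 (LieEquiv.map_lie g)

theorem exists_autMatrix_eq {K' : Type*} [CommRing K'] [Algebra K K']
    {P : Matrix (Fin 3) (Fin 3) K'} (hP : IsHeisenbergMatrix P) (P_unit : IsUnit P.det) :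
    ∃ g : AutExt K K' M, autMatrix K' B.basis g = P := by
  let b := (B.baseChange K').basis
  obtain ⟨f, rfl⟩ := (LinearMap.toMatrix b b).surjective P
  let e := LinearEquiv.ofIsUnitDet P_unit
  exact ⟨{ e with map_lie' := (B.baseChange K').isHeisenbergMatrix_toMatrix_iff.1 hP _ _ }, rfl⟩

end HeisenbergBasis

theorem exists_intMatrix_eq {L : Type*} [LieRing L] (B : HeisenbergBasis ℤ L)
    {P : Matrix (Fin 3) (Fin 3) ℤ} (hP : IsHeisenbergMatrix P) (hdet : P.det ≠ 0) :
    ∃ β : Δ L, intMatrix B.basis β = P := by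
  have det_isUnit : IsUnit (P.map (algebraMap ℤ ℚ)).det := by
    rw [← RingHom.mapMatrix_apply, ← RingHom.map_det, isUnit_iff_ne_zero]
    simpa using hdet
  obtain ⟨g, hg⟩ := B.exists_autMatrix_eq (hP.map _) det_isUnit
  exact ⟨⟨g, (mem_integralEnd_iff B.basis (algebraMap ℤ ℚ).injective_int).2 ⟨P, hg⟩⟩,
    intMatrix_eq_of_autMatrix_eq_map _ hg⟩

end HeisenbergBases

section Witness

variable {R S : Type*} [CommRing R] [CommRing S]

/-- A family of Heisenberg matrices in which `u` can be removed by units of `R` when it is a unit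
itself, whereas otherwise only its class modulo `π ^ 3` and up to units is determined. The powers of
`π` are spread far enough apart for the remaining entries of two conjugating matrices not to
contribute modulo `π ^ 3`. -/
def witness (π u : R) : Matrix (Fin 3) (Fin 3) R :=
  !![π ^ 3, 0, 0; 0, π ^ 9, 0; 1, π ^ 3 * u, π ^ 12]

theorem isHeisenbergMatrix_witness (π u : R) : IsHeisenbergMatrix (witness π u) := by
  refine ⟨rfl, rfl, ?_⟩
  change π ^ 12 = π ^ 3 * π ^ 9 - 0 * 0
  ring

theorem det_witness (π u : R) : (witness π u).det = π ^ 24 := by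
  rw [(isHeisenbergMatrix_witness π u).det_eq]
  change (π ^ 12) ^ 2 = π ^ 24
  ring

theorem witness_map (f : R →+* S) (π u : R) : (witness π u).map f = witness (f π) (f u) := by
  ext i j
  fin_cases i <;> fin_cases j <;> simp [witness]

theorem isHeisenbergMatrix_diagonal (u : R) : IsHeisenbergMatrix (Matrix.diagonal ![u, 1, u]) := by
  simp [IsHeisenbergMatrix, Matrix.diagonal]

theorem witness_unit_eq_mul (π : R) (u : Rˣ) :
    witness π (u : R) = Matrix.diagonal ![(u : R), 1, u] * witness π 1 *
      Matrix.diagonal ![(↑u⁻¹ : R), 1, ↑u⁻¹] := by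
  ext i j
  fin_cases i <;> fin_cases j <;>
    simp [witness, Matrix.mul_diagonal, Matrix.diagonal_mul, mul_comm]

theorem upper_left_eq_of_mul_witness_eq [IsDomain R] {π u : R} (hπ : π ≠ 0)
    {P Q : Matrix (Fin 3) (Fin 3) R} (hP : IsHeisenbergMatrix P)
    (h : P * witness π 1 = witness π u * Q) :
    Q 0 0 = P 0 0 ∧ Q 0 1 = π ^ 6 * P 0 1 ∧ P 1 0 = π ^ 6 * Q 1 0 ∧ Q 1 1 = P 1 1 := by
  obtain ⟨hP02, hP12, -⟩ := hP
  have entry (i j : Fin 3) : ∑ k, P i k * witness π 1 k j = ∑ k, witness π u i k * Q k j :=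
    congrFun₂ h i j
  have h00 : P 0 0 * π ^ 3 = π ^ 3 * Q 0 0 := by
    simpa [Fin.sum_univ_three, witness, hP02] using entry 0 0
  have h01 : P 0 1 * π ^ 9 = π ^ 3 * Q 0 1 := by
    simpa [Fin.sum_univ_three, witness, hP02] using entry 0 1
  have h10 : P 1 0 * π ^ 3 = π ^ 9 * Q 1 0 := by
    simpa [Fin.sum_univ_three, witness, hP12] using entry 1 0
  have h11 : P 1 1 * π ^ 9 = π ^ 9 * Q 1 1 := by
    simpa [Fin.sum_univ_three, witness, hP12] using entry 1 1
  refine ⟨mul_left_cancel₀ (pow_ne_zero 3 hπ) ?_, mul_left_cancel₀ (pow_ne_zero 3 hπ) ?_,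
    mul_left_cancel₀ (pow_ne_zero 3 hπ) ?_, mul_left_cancel₀ (pow_ne_zero 9 hπ) ?_⟩
  · linear_combination -h00
  · linear_combination -h01
  · linear_combination h10
  · linear_combination -h11

theorem exists_unit_dvd_sub_of_mul_witness_eq [IsDomain R] {π u : R} (hπ : π ≠ 0)
    {P Q : Matrix (Fin 3) (Fin 3) R} (hP : IsHeisenbergMatrix P) (hdet : IsUnit P.det)
    (h : P * witness π 1 = witness π u * Q) : ∃ ε : Rˣ, π ^ 3 ∣ u - ε := by
  have P22_unit : IsUnit (P 2 2) := (isUnit_pow_iff two_ne_zero).1 (hP.det_eq ▸ hdet)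
  obtain ⟨hQ00, hQ01, hP10, hQ11⟩ := upper_left_eq_of_mul_witness_eq hπ hP h
  obtain ⟨-, -, hP22⟩ := hP
  have entry (j : Fin 3) : ∑ k, P 2 k * witness π 1 k j = ∑ k, witness π u 2 k * Q k j :=
    congrFun₂ h 2 j
  have h20 : P 2 0 * π ^ 3 + P 2 2 = Q 0 0 + π ^ 3 * u * Q 1 0 + π ^ 12 * Q 2 0 := by
    simpa [Fin.sum_univ_three, witness] using entry 0
  have h21 : P 2 1 * π ^ 9 + P 2 2 * π ^ 3 =
      Q 0 1 + π ^ 3 * u * Q 1 1 + π ^ 12 * Q 2 1 := by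
    simpa [Fin.sum_univ_three, witness] using entry 1
  have dvd_sub_P00 : π ^ 3 ∣ P 2 2 - P 0 0 :=
    ⟨u * Q 1 0 + π ^ 9 * Q 2 0 - P 2 0, by linear_combination h20 + hQ00⟩
  have dvd_sub_mul_P11 : π ^ 3 ∣ P 2 2 - u * P 1 1 :=
    ⟨P 0 1 + π ^ 6 * Q 2 1 - π ^ 3 * P 2 1, mul_left_cancel₀ (pow_ne_zero 3 hπ) <| by
      linear_combination h21 + hQ01 + π ^ 3 * u * hQ11⟩
  have dvd_sub_mul : π ^ 3 ∣ P 2 2 - P 0 0 * P 1 1 :=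
    ⟨-(π ^ 3 * P 0 1 * Q 1 0), by linear_combination hP22 - P 0 1 * hP10⟩
  have mul_sub_eq : P 2 2 * (u - P 2 2) = u * (P 2 2 - P 0 0 * P 1 1) -
      u * P 1 1 * (P 2 2 - P 0 0) - P 2 2 * (P 2 2 - u * P 1 1) := by ring
  refine ⟨P22_unit.unit, P22_unit.dvd_mul_left.1 ?_⟩
  rw [IsUnit.unit_spec, mul_sub_eq]
  exact dvd_sub (dvd_sub (dvd_mul_of_dvd_right dvd_sub_mul _)
    (dvd_mul_of_dvd_right dvd_sub_P00 _)) (dvd_mul_of_dvd_right dvd_sub_mul_P11 _)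

end Witness

section TwoCosets

variable {L : Type*} [LieRing L]

theorem isUnit_algebraMap_padicInt_of_isCoprime {p : Nat.Primes} {n : ℤ}
    (h : IsCoprime n (p : ℤ)) : IsUnit (algebraMap ℤ ℤ_[p] n) := by
  rw [PadicInt.isUnit_iff, eq_intCast]
  exact PadicInt.norm_intCast_eq_one_iff.2 h

theorem map_intMatrix_padicInt {ι : Type*} [Fintype ι] [DecidableEq ι] (b : Module.Basis ι ℤ L)
    (β : Δ L) (p : Nat.Primes) :
    ((intMatrix b β).map (algebraMap ℤ ℤ_[p])).map (algebraMap ℤ_[p] ℚ_[p]) =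
      autMatrix ℚ_[p] b (eta L β p) := by
  rw [autMatrix_eta, Matrix.map_map, ← RingHom.coe_comp, ← IsScalarTower.algebraMap_eq]

theorem eta_mem_Γloc_of_isCoprime_det {ι : Type*} [Fintype ι] [DecidableEq ι]
    (b : Module.Basis ι ℤ L) {β : Δ L} {q : Nat.Primes}
    (h : IsCoprime (intMatrix b β).det (q : ℤ)) : eta L β q ∈ Γloc L q := by
  refine (mem_integralAut_iff b (IsFractionRing.injective _ _)).2
    ⟨_, ?_, (map_intMatrix_padicInt b β q).symm⟩
  rw [← RingHom.mapMatrix_apply, ← RingHom.map_det]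
  exact isUnit_algebraMap_padicInt_of_isCoprime h

variable {B : HeisenbergBasis ℤ L}

theorem exists_mem_Γloc_autMatrix_eq_map (B : HeisenbergBasis ℤ L) {p : Nat.Primes}
    {P : Matrix (Fin 3) (Fin 3) ℤ_[p]} (hP : IsHeisenbergMatrix P) (P_unit : IsUnit P.det) :
    ∃ x ∈ Γloc L p, autMatrix ℚ_[p] B.basis x = P.map (algebraMap ℤ_[p] ℚ_[p]) := by
  have det_isUnit := P_unit.map (algebraMap ℤ_[p] ℚ_[p])
  rw [RingHom.map_det] at det_isUnit
  obtain ⟨x, hx⟩ := B.exists_autMatrix_eq (hP.map _) det_isUnit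
  exact ⟨x, (mem_integralAut_iff B.basis (IsFractionRing.injective _ _)).2 ⟨P, P_unit, hx⟩, hx⟩

theorem exists_autMatrix_eq_map_of_mem_Γ (B : HeisenbergBasis ℤ L) {x : AutExt ℤ ℚ L}
    (hx : x ∈ Γ L) :
    ∃ P : Matrix (Fin 3) (Fin 3) ℤ, IsHeisenbergMatrix P ∧ IsUnit P.det ∧
      autMatrix ℚ B.basis x = P.map (algebraMap ℤ ℚ) := by
  obtain ⟨P, hdet, hP⟩ := (mem_integralAut_iff B.basis (algebraMap ℤ ℚ).injective_int).1 hx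
  exact ⟨P, (isHeisenbergMatrix_map_iff (algebraMap ℤ ℚ).injective_int).1
    (hP ▸ B.isHeisenbergMatrix_autMatrix x), hdet, hP⟩

theorem not_pow_three_dvd_one_add_sub_unit {p : ℤ} (hp : 2 ≤ p) (ε : ℤˣ) :
    ¬ p ^ 3 ∣ 1 + p - ε := by
  have four_mul_le : 4 * p ≤ p ^ 3 := by nlinarith [mul_le_mul hp hp (by norm_num) (by linarith)]
  have ε_bounds : -1 ≤ (ε : ℤ) ∧ (ε : ℤ) ≤ 1 := by
    obtain rfl | rfl := Int.units_eq_one_or ε <;> norm_num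
  intro dvd
  have := Int.le_of_dvd (by linarith) dvd
  linarith

theorem heckeCoset_mk_ne_of_intMatrix_eq_witness {p : ℤ} (hp : 2 ≤ p) {β β' : Δ L}
    (hβ : intMatrix B.basis β = witness p 1) (hβ' : intMatrix B.basis β' = witness p (1 + p)) :
    HeckeCoset.mk (Γ L) (Γ L) β ≠ HeckeCoset.mk (Γ L) (Γ L) β' := by
  intro h
  obtain ⟨x, hx, y, hy, eq_mul⟩ := heckeCoset_mk_eq_mk_iff.1 h
  obtain ⟨P, hP, hdet, hxP⟩ := exists_autMatrix_eq_map_of_mem_Γ B hx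
  obtain ⟨Q, -, -, hyQ⟩ := exists_autMatrix_eq_map_of_mem_Γ B (inv_mem hy)
  have mul_witness : P * witness p 1 = witness p (1 + p) * Q := by
    refine Matrix.map_injective (algebraMap ℤ ℚ).injective_int ?_
    change (P * _).map _ = (_ * Q).map _
    rw [Matrix.map_mul, Matrix.map_mul, ← hβ, ← hβ', ← autMatrix_eq_map_intMatrix,
      ← autMatrix_eq_map_intMatrix, ← hxP, ← hyQ, ← map_mul, ← map_mul, eq_mul,
      mul_inv_cancel_right]
  obtain ⟨ε, hε⟩ :=
    exists_unit_dvd_sub_of_mul_witness_eq (by linarith : p ≠ 0) hP hdet mul_witness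
  exact not_pow_three_dvd_one_add_sub_unit hp ε hε

theorem exists_eta_eq_mul_of_isCoprime {p : Nat.Primes} {π u : ℤ} (hu : IsCoprime u (p : ℤ))
    {β β' : Δ L} (hβ : intMatrix B.basis β = witness π 1)
    (hβ' : intMatrix B.basis β' = witness π u) :
    ∃ x ∈ Γloc L p, ∃ y ∈ Γloc L p, eta L β' p = x * eta L β p * y := by
  obtain ⟨v, hv⟩ := isUnit_algebraMap_padicInt_of_isCoprime hu
  have isUnit_det_diagonal (w : ℤ_[p]ˣ) :
      IsUnit (Matrix.diagonal ![(w : ℤ_[p]), 1, w]).det := by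
    simp [Matrix.det_diagonal, Fin.prod_univ_three]
  obtain ⟨x, hx, hxv⟩ := exists_mem_Γloc_autMatrix_eq_map B (isHeisenbergMatrix_diagonal _)
    (isUnit_det_diagonal v)
  obtain ⟨y, hy, hyv⟩ := exists_mem_Γloc_autMatrix_eq_map B (isHeisenbergMatrix_diagonal _)
    (isUnit_det_diagonal v⁻¹)
  refine ⟨x, hx, y, hy, autMatrix_injective (K := ℚ_[p]) B.basis ?_⟩
  rw [map_mul, map_mul, hxv, hyv, ← map_intMatrix_padicInt, ← map_intMatrix_padicInt, hβ, hβ',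
    ← Matrix.map_mul, ← Matrix.map_mul, witness_map (algebraMap ℤ ℤ_[p]),
    witness_map (algebraMap ℤ ℤ_[p]), ← hv, map_one, witness_unit_eq_mul]

theorem eta_mem_doubleCoset_ofLocal {p : Nat.Primes} {u : ℤ} (hu : IsCoprime u (p : ℤ))
    {β β' : Δ L} (hβ : intMatrix B.basis β = witness (p : ℤ) 1)
    (hβ' : intMatrix B.basis β' = witness (p : ℤ) u) :
    eta L β' ∈ DoubleCoset.doubleCoset (ofLocal L p (eta L β p)) (Γhat L) (Γhat L) := by
  refine mem_doubleCoset_Γhat_iff.2 fun q => ?_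
  obtain rfl | hqp := eq_or_ne q p
  · have ofLocal_apply : ofLocal L q (eta L β q) q = eta L β q := Pi.mulSingle_eq_same _ _
    rw [ofLocal_apply]
    exact exists_eta_eq_mul_of_isCoprime hu hβ hβ'
  · have ofLocal_apply : ofLocal L p (eta L β p) q = 1 := Pi.mulSingle_eq_of_ne hqp _
    refine ⟨_, eta_mem_Γloc_of_isCoprime_det B.basis ?_, 1, one_mem _, by
      rw [ofLocal_apply, mul_one, mul_one]⟩
    rw [hβ', det_witness]
    exact (Nat.isCoprime_iff_coprime.2 ((Nat.coprime_primes p.2 q.2).2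
      fun h => hqp (Subtype.ext h.symm))).pow_left

theorem exists_one_lt_encard_cosetsOver (B : HeisenbergBasis ℤ L) (p : Nat.Primes) :
    ∃ α ∈ Δloc L p, 1 < (cosetsOver L (ofLocal L p α)).encard := by
  have two_le : (2 : ℤ) ≤ p := mod_cast p.2.two_le
  have exists_witness (u : ℤ) : ∃ β : Δ L, intMatrix B.basis β = witness (p : ℤ) u :=
    exists_intMatrix_eq B (isHeisenbergMatrix_witness _ _)
      (det_witness (p : ℤ) u ▸ pow_ne_zero _ (by linarith))
  obtain ⟨β, hβ⟩ := exists_witness 1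
  obtain ⟨β', hβ'⟩ := exists_witness (1 + p)
  have isCoprime_one_add : IsCoprime (1 + p : ℤ) p := ⟨1, -1, by ring⟩
  exact ⟨eta L β p, eta_mem_Δloc β p, Set.one_lt_encard_iff.2 ⟨_, _,
    mk_mem_cosetsOver_iff.2 (eta_mem_doubleCoset_ofLocal isCoprime_one_left hβ hβ),
    mk_mem_cosetsOver_iff.2 (eta_mem_doubleCoset_ofLocal isCoprime_one_add hβ hβ'),
    heckeCoset_mk_ne_of_intMatrix_eq_witness two_le hβ hβ'⟩⟩

end TwoCosets

section HeisenbergLieAlgebra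

theorem top_lie_top_lie_top_le_ker {R M N : Type*} [CommRing R] [LieRing M] [LieAlgebra R M]
    [LieRing N] [LieAlgebra R N] (f : M →ₗ⁅R⁆ N) (h : ∀ u v w : N, ⁅u, ⁅v, w⁆⁆ = 0) :
    ⁅(⊤ : LieIdeal R M), ⁅(⊤ : LieIdeal R M), (⊤ : LieIdeal R M)⁆⁆ ≤ f.ker := by
  have lie_le_comap_center :
      ⁅(⊤ : LieIdeal R M), (⊤ : LieIdeal R M)⁆ ≤ (LieAlgebra.center R N).comap f := by
    refine (LieSubmodule.lie_le_iff _ _ _).2 fun v _ w _ => LieIdeal.mem_comap.2 ?_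
    rw [LieHom.map_lie]
    exact fun u => h u _ _
  refine (LieSubmodule.lie_le_iff _ _ _).2 fun u _ m hm => ?_
  rw [LieHom.mem_ker, LieHom.map_lie]
  exact LieIdeal.mem_comap.1 (lie_le_comap_center hm) _

section FreeLie

variable {X M : Type*} [LieRing M]

/-- The universal property of the free Lie ring. Instance search finds on `FreeLieAlgebra ℤ X` the
`ℤ`-structure common to all Lie rings, while `FreeLieAlgebra.lift` refers to
`FreeLieAlgebra.instLieAlgebra`; this is `FreeLieAlgebra.lift` for the former. -/
def freeLieLift (f : X → M) : FreeLieAlgebra ℤ X →ₗ⁅ℤ⁆ M where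
  toFun := FreeLieAlgebra.lift ℤ f
  map_add' := map_add _
  map_smul' n x := map_zsmul (FreeLieAlgebra.lift ℤ f) n x
  map_lie' := LieHom.map_lie _ _ _

theorem freeLieLift_of (f : X → M) (i : X) : freeLieLift f (FreeLieAlgebra.of ℤ i) = f i :=
  FreeLieAlgebra.lift_of_apply f i

theorem freeLie_hom_ext {f g : FreeLieAlgebra ℤ X →ₗ⁅ℤ⁆ M}
    (h : ∀ i, f (FreeLieAlgebra.of ℤ i) = g (FreeLieAlgebra.of ℤ i)) : f = g := by
  let algHom (f : FreeLieAlgebra ℤ X →ₗ⁅ℤ⁆ M) :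
      @LieHom ℤ (FreeLieAlgebra ℤ X) M _ _ (FreeLieAlgebra.instLieAlgebra ℤ X) _ _ :=
    { toFun := f
      map_add' := map_add f
      map_smul' := fun n x => map_zsmul f n x
      map_lie' := LieHom.map_lie f _ _ }
  have algHom_eq : algHom f = algHom g := FreeLieAlgebra.hom_ext h
  exact LieHom.ext fun x => congrArg (fun F => F x) algHom_eq

end FreeLie

namespace Heisenberg

/-- The quotient map `F → F / [F, [F, F]]`. -/
def mk : FreeLieAlgebra ℤ (Fin 2) →ₗ⁅ℤ⁆ Heisenberg where
  toFun := LieSubmodule.Quotient.mk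
  map_add' _ _ := rfl
  map_smul' _ _ := rfl
  map_lie' := rfl

theorem mk_surjective : Function.Surjective mk := Quot.mk_surjective

theorem mk_eq_zero_iff {x : FreeLieAlgebra ℤ (Fin 2)} :
    mk x = 0 ↔ x ∈ ⁅(⊤ : LieIdeal ℤ (FreeLieAlgebra ℤ (Fin 2))),
      ⁅(⊤ : LieIdeal ℤ (FreeLieAlgebra ℤ (Fin 2))),
        (⊤ : LieIdeal ℤ (FreeLieAlgebra ℤ (Fin 2)))⁆⁆ :=
  LieSubmodule.Quotient.mk_eq_zero'

theorem lie_lie_eq_zero (u v w : Heisenberg) : ⁅u, ⁅v, w⁆⁆ = 0 := by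
  obtain ⟨u, rfl⟩ := mk_surjective u
  obtain ⟨v, rfl⟩ := mk_surjective v
  obtain ⟨w, rfl⟩ := mk_surjective w
  rw [← LieHom.map_lie, ← LieHom.map_lie, mk_eq_zero_iff]
  exact LieSubmodule.lie_mem_lie (LieSubmodule.mem_top _)
    (LieSubmodule.lie_mem_lie (LieSubmodule.mem_top _) (LieSubmodule.mem_top _))

end Heisenberg

namespace HeisenbergBasis

variable {M : Type*} [LieRing M] (B : HeisenbergBasis ℤ M)

/-- The homomorphism from the free Lie ring sending the generators to `e₀` and `e₁`. -/
def ofFreeLie : FreeLieAlgebra ℤ (Fin 2) →ₗ⁅ℤ⁆ M :=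
  freeLieLift ![B.basis 0, B.basis 1]

/-- The homomorphism to the Heisenberg Lie algebra sending `e₀` and `e₁` to the generators. -/
def toHeisenberg : M →ₗ⁅ℤ⁆ Heisenberg :=
  B.lift (Heisenberg.lie_lie_eq_zero · (Heisenberg.mk (FreeLieAlgebra.of ℤ 0))
    (Heisenberg.mk (FreeLieAlgebra.of ℤ 1)))

theorem ofFreeLie_of_zero : B.ofFreeLie (FreeLieAlgebra.of ℤ 0) = B.basis 0 :=
  freeLieLift_of _ 0

theorem ofFreeLie_of_one : B.ofFreeLie (FreeLieAlgebra.of ℤ 1) = B.basis 1 :=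
  freeLieLift_of _ 1

theorem ofFreeLie_surjective : Function.Surjective B.ofFreeLie := fun u =>
  ⟨B.basis.repr u 0 • FreeLieAlgebra.of ℤ 0 + B.basis.repr u 1 • FreeLieAlgebra.of ℤ 1 +
    B.basis.repr u 2 • ⁅FreeLieAlgebra.of ℤ (0 : Fin 2), FreeLieAlgebra.of ℤ (1 : Fin 2)⁆, by
    rw [map_add, map_add, map_smul, map_smul, map_smul, LieHom.map_lie, ofFreeLie_of_zero,
      ofFreeLie_of_one, ← B.basis_two, ← B.eq_smul_add_smul]⟩

theorem toHeisenberg_ofFreeLie (x : FreeLieAlgebra ℤ (Fin 2)) :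
    B.toHeisenberg (B.ofFreeLie x) = Heisenberg.mk x := by
  suffices comp_eq : B.toHeisenberg.comp B.ofFreeLie = Heisenberg.mk from
    LieHom.congr_fun comp_eq x
  refine freeLie_hom_ext fun i => ?_
  rw [LieHom.comp_apply]
  fin_cases i
  · exact (congrArg _ B.ofFreeLie_of_zero).trans (B.lift_basis_zero _)
  · exact (congrArg _ B.ofFreeLie_of_one).trans (B.lift_basis_one _)

theorem toHeisenberg_bijective : Function.Bijective B.toHeisenberg := by
  constructor
  · refine (injective_iff_map_eq_zero B.toHeisenberg).2 fun u hu => ?_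
    obtain ⟨x, rfl⟩ := B.ofFreeLie_surjective u
    rw [toHeisenberg_ofFreeLie, Heisenberg.mk_eq_zero_iff] at hu
    exact LieHom.mem_ker.1 (top_lie_top_lie_top_le_ker B.ofFreeLie B.lie_lie_eq_zero hu)
  · intro u
    obtain ⟨x, rfl⟩ := Heisenberg.mk_surjective u
    exact ⟨_, B.toHeisenberg_ofFreeLie x⟩

end HeisenbergBasis

/-- A coordinate model of the Heisenberg Lie algebra: `ℤ³` with `⁅e₀, e₁⁆ = e₂` and `e₂` central. -/
def HeisenbergModel : Type := Fin 3 → ℤ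

namespace HeisenbergModel

instance : AddCommGroup HeisenbergModel := inferInstanceAs (AddCommGroup (Fin 3 → ℤ))

instance : Bracket HeisenbergModel HeisenbergModel where
  bracket u v := (![0, 0, u 0 * v 1 - u 1 * v 0] : Fin 3 → ℤ)

theorem lie_apply_zero (u v : HeisenbergModel) : ⁅u, v⁆ 0 = 0 := rfl

theorem lie_apply_one (u v : HeisenbergModel) : ⁅u, v⁆ 1 = 0 := rfl

theorem lie_apply_two (u v : HeisenbergModel) : ⁅u, v⁆ 2 = u 0 * v 1 - u 1 * v 0 := rfl

theorem add_apply (u v : HeisenbergModel) (i : Fin 3) : (u + v) i = u i + v i := rfl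

theorem zero_apply (i : Fin 3) : (0 : HeisenbergModel) i = 0 := rfl

@[ext]
theorem ext {u v : HeisenbergModel} (h0 : u 0 = v 0) (h1 : u 1 = v 1) (h2 : u 2 = v 2) : u = v :=
  funext (Fin.forall_fin_succ.2 ⟨h0, Fin.forall_fin_two.2 ⟨h1, h2⟩⟩)

instance : LieRing HeisenbergModel where
  add_lie u v w := by
    ext <;> simp only [lie_apply_zero, lie_apply_one, lie_apply_two, add_apply] <;> ring
  lie_add u v w := by
    ext <;> simp only [lie_apply_zero, lie_apply_one, lie_apply_two, add_apply] <;> ring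
  lie_self u := by
    ext
    exacts [rfl, rfl, sub_eq_zero.2 (mul_comm _ _)]
  leibniz_lie u v w := by
    ext <;> simp only [lie_apply_zero, lie_apply_one, lie_apply_two, add_apply] <;> ring

/-- The standard basis of `ℤ³`. -/
def basis : Module.Basis (Fin 3) ℤ HeisenbergModel :=
  (Pi.basisFun ℤ (Fin 3) : Module.Basis (Fin 3) ℤ (Fin 3 → ℤ))

theorem basis_apply (i j : Fin 3) : basis i j = Pi.single (M := fun _ => ℤ) i 1 j :=
  congrFun (Pi.basisFun_apply ℤ (Fin 3) i) j

/-- The standard basis of `ℤ³` as a Heisenberg basis. -/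
def heisenbergBasis : HeisenbergBasis ℤ HeisenbergModel where
  basis := basis
  basis_two := by
    ext <;> simp [lie_apply_zero, lie_apply_one, lie_apply_two, basis_apply]
  lie_basis_two i := by
    ext <;> simp [lie_apply_zero, lie_apply_one, lie_apply_two, basis_apply, zero_apply]

end HeisenbergModel

/-- The two generators of the Heisenberg Lie algebra together with their bracket. -/
def heisenbergBasis : HeisenbergBasis ℤ Heisenberg :=
  HeisenbergModel.heisenbergBasis.map
    (LieEquiv.ofBijective _ HeisenbergModel.heisenbergBasis.toHeisenberg_bijective)

end HeisenbergLieAlgebra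

end LieHecke

end

theorem mainTheorem2 :
    (∀ p : Nat.Primes, ∃ α ∈ LieHecke.Δloc LieHecke.Heisenberg p,
      1 < (LieHecke.cosetsOver LieHecke.Heisenberg
        (LieHecke.ofLocal LieHecke.Heisenberg p α)).encard) ∧
    (∀ α ∈ LieHecke.Δhat LieHecke.Heisenberg,
      (LieHecke.cosetsOver LieHecke.Heisenberg α).Finite) ∧
    ¬ Function.Surjective (LieHecke.etaStar LieHecke.Heisenberg) := by
  refine ⟨LieHecke.exists_one_lt_encard_cosetsOver LieHecke.heisenbergBasis,
    fun α _ => LieHecke.cosetsOver_finite LieHecke.heisenbergBasis.basis α, ?_⟩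
  obtain ⟨α, -, one_lt_encard⟩ := LieHecke.exists_one_lt_encard_cosetsOver
    LieHecke.heisenbergBasis ⟨2, Nat.prime_two⟩
  exact LieHecke.not_surjective_etaStar_of_one_lt_encard one_lt_encard
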